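/- Let $M$ be a smooth compact oriented surface without boundary, smoothly immersed into Euclidean space $\mathbb{E}^3$, with unit normal field $n$ and shape operator $S(p)=-dn_p$ acting on the tangent plane $T_p$. Put $$\mathcal{K}=\max_{p}\|S(p)\|_{\mathrm{op}},\qquad \mathcal{K}'=\max_{p}\max_{v\in T_p,\ \|v\|=1}\|\nabla_v S(p)\|_{\mathrm{op}},$$ where $\nabla$ is the Levi-Civita connection of the induced metric. A discrete net of curvature lines on $M$ is a cellular decomposition of $M$ whose attaching maps are homeomorphisms, in which the intersection of any two (closed) cells is either empty or a single cell, whose edges are smoothly embedded segments of curvature lines, whose non-umbilical vertices have valence four, and whose umbilical vertices have valence greater than two. Let $p$ be a non-umbilical vertex of such a net, and let $\epsilon$ be the maximum of the intrinsic lengths of the edges emanating from $p$. Let $(v_1,v_2,n)$ be a Darboux frame at $p$, that is, $v_1,v_2\in T_p$ are orthonormal principal directions at $p$ with $v_1\times v_2=n(p)$; let $\kappa_1,\kappa_2$ be the corresponding principal curvatures, and $\delta_\kappa(p)=\kappa_2-\kappa_1$. Let $e$ be an edge emanating from $p$, and let $\mathbf{e}\in\mathbb{E}^3$ be its straight edge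 vector, pointing from (the image of) $p$ to (the image of) the other endpoint of $e$. Then the curved edge $e$ is tangent at $p$ to exactly one of the two principal directions $\pm v_1$, $\pm v_2$; this is the principal direction canonically associated with $\mathbf{e}$. Let $e_d$ be the tangential deviation of $\mathbf{e}$ with respect to it: $e_d=|\mathbf{e}\cdot v_2|$ if $\mathbf{e}$ is associated with $v_1$, and $e_d=|\mathbf{e}\cdot v_1|$ if $\mathbf{e}$ is associated with $v_2$. Then $$|\delta_\kappa(p)\,e_d|\le(\mathcal{K}^2+4\mathcal{K}')\,\epsilon^2 .$$ -/

import Mathlib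

open Set Metric Topology
open scoped Manifold ContDiff InnerProductSpace Matrix

/-- Euclidean three-space. -/
abbrev E3 : Type := EuclideanSpace ℝ (Fin 3)

/-- The cross product of Euclidean three-space. -/
noncomputable def E3.cross (a b : E3) : E3 :=
  WithLp.toLp 2 (crossProduct (WithLp.ofLp a) (WithLp.ofLp b))

/-- The differential at `p` of a vector-valued function on a surface. -/
noncomputable def surfaceDiff {M : Type*} [TopologicalSpace M]
    [ChartedSpace (EuclideanSpace ℝ (Fin 2)) M] {F : Type*} [NormedAddCommGroup F]
    [NormedSpace ℝ F] (g : M → F) (p : M) : TangentSpace (𝓡 2) p →L[ℝ] F :=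
  mfderiv (𝓡 2) 𝓘(ℝ, F) g p

theorem surfaceDiff_clm_apply {M : Type*} [TopologicalSpace M]
    [ChartedSpace (EuclideanSpace ℝ (Fin 2)) M] {F : Type*} [NormedAddCommGroup F]
    [NormedSpace ℝ F] (g : M → F →L[ℝ] F) (f : M → F) (p : M)
    (hg : MDifferentiableAt (𝓡 2) 𝓘(ℝ, F →L[ℝ] F) g p)
    (hf : MDifferentiableAt (𝓡 2) 𝓘(ℝ, F) f p) (ξ : TangentSpace (𝓡 2) p) :
    surfaceDiff (fun q => g q (f q)) p ξ =
      g p (surfaceDiff f p ξ) + surfaceDiff g p ξ (f p) := by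
  let A : EuclideanSpace ℝ (Fin 2) →L[ℝ] (F →L[ℝ] F) := surfaceDiff g p
  let B : EuclideanSpace ℝ (Fin 2) →L[ℝ] F := surfaceDiff f p
  have h1 : HasFDerivWithinAt (fun x => g ((extChartAt (𝓡 2) p).symm x)) A (range (𝓡 2))
    (extChartAt (𝓡 2) p p) := hg.hasMFDerivAt.2
  have h2 : HasFDerivWithinAt (fun x => f ((extChartAt (𝓡 2) p).symm x)) B (range (𝓡 2))
    (extChartAt (𝓡 2) p p) := hf.hasMFDerivAt.2
  have h3 := h1.clm_apply h2
  rw [extChartAt_to_inv] at h3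
  have key : HasMFDerivAt (𝓡 2) 𝓘(ℝ, F) (fun q => g q (f q)) p
      ((g p).comp B + A.flip (f p) : EuclideanSpace ℝ (Fin 2) →L[ℝ] F) :=
    ⟨hg.continuousAt.clm_apply hf.continuousAt, h3⟩
  have h4 : surfaceDiff (fun q => g q (f q)) p = _ := key.mfderiv
  rw [h4]
  rfl

/-- A smooth surface `M` without boundary, smoothly immersed into Euclidean three-space and
oriented. As the ambient space is oriented, the orientation is given by the unit normal field. -/
structure OrientedImmersedSurface (M : Type*) [TopologicalSpace M]
    [ChartedSpace (EuclideanSpace ℝ (Fin 2)) M] [IsManifold (𝓡 2) ∞ M] where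
  /-- the immersion -/
  imm : M → E3
  contMDiff_imm : ContMDiff (𝓡 2) 𝓘(ℝ, E3) ∞ imm
  injective_differential : ∀ p : M, Function.Injective (surfaceDiff imm p)
  /-- the unit normal field -/
  normal : M → E3
  contMDiff_normal : ContMDiff (𝓡 2) 𝓘(ℝ, E3) ∞ normal
  norm_normal : ∀ p : M, ‖normal p‖ = 1
  normal_orthogonal : ∀ (p : M) (ξ : TangentSpace (𝓡 2) p),
    inner ℝ (surfaceDiff imm p ξ) (normal p) = 0

namespace OrientedImmersedSurface

variable {M : Type*} [TopologicalSpace M] [ChartedSpace (EuclideanSpace ℝ (Fin 2)) M]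
  [IsManifold (𝓡 2) ∞ M] (Sg : OrientedImmersedSurface M)

/-- The tangent plane at `p`, as a linear subspace of Euclidean space. With the inner product
inherited from there, it is the tangent space of `M` at `p` with the induced metric. -/
noncomputable def tangentPlane (p : M) : Submodule ℝ E3 :=
  LinearMap.range (surfaceDiff Sg.imm p).toLinearMap

/-- The isomorphism between the abstract tangent space and the tangent plane. -/
noncomputable def tangentEquiv (p : M) : TangentSpace (𝓡 2) p ≃ₗ[ℝ] Sg.tangentPlane p :=
  LinearEquiv.ofInjective (surfaceDiff Sg.imm p).toLinearMap (Sg.injective_differential p)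

/-- The orthogonal projection of Euclidean space onto the tangent plane at `p`. -/
noncomputable def proj (p : M) : E3 →L[ℝ] Sg.tangentPlane p :=
  (Sg.tangentPlane p).orthogonalProjectionOnto

/-- The directional derivative at `p` of a vector-valued function on the surface, in the
direction of a vector of the tangent plane. -/
noncomputable def dirDeriv {F : Type*} [NormedAddCommGroup F] [NormedSpace ℝ F] (g : M → F)
    (p : M) (v : Sg.tangentPlane p) : F :=
  surfaceDiff g p ((Sg.tangentEquiv p).symm v)

theorem dirDeriv_add {F : Type*} [NormedAddCommGroup F] [NormedSpace ℝ F] (g : M → F)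
    (p : M) (v w : Sg.tangentPlane p) :
    Sg.dirDeriv g p (v + w) = Sg.dirDeriv g p v + Sg.dirDeriv g p w := by
  simp only [dirDeriv, map_add]

theorem dirDeriv_smul {F : Type*} [NormedAddCommGroup F] [NormedSpace ℝ F] (g : M → F)
    (p : M) (c : ℝ) (v : Sg.tangentPlane p) :
    Sg.dirDeriv g p (c • v) = c • Sg.dirDeriv g p v := by
  simp only [dirDeriv, map_smul]

/-- The shape (Weingarten) operator `S(p) = -dn` as an endomorphism of the tangent plane. (The
derivative of the unit normal is tangential; the projection only adjusts its codomain.) -/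
noncomputable def shapeOperator (p : M) : Sg.tangentPlane p →L[ℝ] Sg.tangentPlane p :=
  LinearMap.toContinuousLinearMap
    { toFun := fun v => -Sg.proj p (Sg.dirDeriv Sg.normal p v)
      map_add' := fun v w => by rw [dirDeriv_add, map_add, neg_add]
      map_smul' := fun c v => by
        rw [dirDeriv_smul, map_smul, RingHom.id_apply, smul_neg] }

/-- The extension of an endomorphism of the tangent plane to Euclidean space which vanishes on
the normal line. -/
noncomputable def extendEnd (p : M) (A : Sg.tangentPlane p →L[ℝ] Sg.tangentPlane p) :
    E3 →L[ℝ] E3 :=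
  (Sg.tangentPlane p).subtypeL ∘L A ∘L Sg.proj p

/-- The Levi-Civita connection of the induced metric: the covariant derivative of a tangential
vector field is the tangential part of its directional derivative in Euclidean space. -/
noncomputable def covDeriv (W : ∀ q : M, Sg.tangentPlane q) (p : M) (v : Sg.tangentPlane p) :
    Sg.tangentPlane p :=
  Sg.proj p (Sg.dirDeriv (fun q => (W q : E3)) p v)

/-- The covariant derivative `∇_v S (p)` of the shape operator: the tangential part of the
directional derivative of the (extended) field of shape operators. The lemma
`nablaShape_apply` below is the defining Leibniz rule of this tensor. -/
noncomputable def nablaShape (p : M) (v : Sg.tangentPlane p) :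
    Sg.tangentPlane p →L[ℝ] Sg.tangentPlane p :=
  Sg.proj p ∘L
    Sg.dirDeriv (fun q => Sg.extendEnd q (Sg.shapeOperator q)) p v ∘L
      (Sg.tangentPlane p).subtypeL

theorem nablaShape_apply (p : M) (v : Sg.tangentPlane p) (W : ∀ q : M, Sg.tangentPlane q)
    (hW : MDifferentiableAt (𝓡 2) 𝓘(ℝ, E3) (fun q => (W q : E3)) p)
    (hS : MDifferentiableAt (𝓡 2) 𝓘(ℝ, E3 →L[ℝ] E3)
      (fun q => Sg.extendEnd q (Sg.shapeOperator q)) p) :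
    Sg.nablaShape p v (W p) =
      Sg.covDeriv (fun q => Sg.shapeOperator q (W q)) p v
        - Sg.shapeOperator p (Sg.covDeriv W p v) := by
  have hext : ∀ q, (Sg.shapeOperator q (W q) : E3) =
      Sg.extendEnd q (Sg.shapeOperator q) (W q : E3) := fun q => by
    simp [extendEnd, proj]
  simp only [covDeriv, dirDeriv, hext]
  rw [surfaceDiff_clm_apply _ _ p hS hW, map_add]
  simp [nablaShape, dirDeriv, extendEnd, proj]

/-- The bound `𝒦 = max_p ‖S(p)‖` on the normal curvatures. -/
noncomputable def curvatureBound : ℝ :=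
  ⨆ p : M, ‖Sg.shapeOperator p‖

/-- The bound `𝒦' = max_p max_{‖v‖ = 1} ‖∇_v S(p)‖` on the derivatives of the curvatures. -/
noncomputable def curvatureDerivBound : ℝ :=
  ⨆ p : M, ⨆ v : sphere (0 : Sg.tangentPlane p) 1, ‖Sg.nablaShape p v‖

/-- A point is umbilical if the shape operator is a multiple of the identity. -/
def IsUmbilical (p : M) : Prop :=
  ∃ k : ℝ, ∀ v : Sg.tangentPlane p, Sg.shapeOperator p v = k • v

/-- A principal direction at `p`: a nonzero tangent vector which is an eigenvector of the shape
operator. -/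
def IsPrincipalDirection (p : M) (w : E3) : Prop :=
  ∃ v : Sg.tangentPlane p, (v : E3) = w ∧ v ≠ 0 ∧ ∃ k : ℝ, Sg.shapeOperator p v = k • v

/-- A Darboux frame `(v₁, v₂, n)` at `p`: here `v₁ = v 0` and `v₂ = v 1` are orthonormal principal
directions with `v₁ × v₂ = n`. -/
structure DarbouxFrame (p : M) where
  v : Fin 2 → Sg.tangentPlane p
  orthonormal : Orthonormal ℝ v
  principal : ∀ i, Sg.IsPrincipalDirection p (v i)
  cross_eq : E3.cross (v 0) (v 1) = Sg.normal p

/-- The principal curvature `κ₁` (for `i = 0`) or `κ₂` (for `i = 1`) of a Darboux frame: the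
normal curvature in the principal direction `v i`. -/
noncomputable def DarbouxFrame.kappa {Sg : OrientedImmersedSurface M} {p : M}
    (D : Sg.DarbouxFrame p) (i : Fin 2) : ℝ :=
  inner ℝ (Sg.shapeOperator p (D.v i)) (D.v i)

/-- The difference `δ_κ = κ₂ - κ₁` of the principal curvatures. -/
noncomputable def DarbouxFrame.deltaKappa {Sg : OrientedImmersedSurface M} {p : M}
    (D : Sg.DarbouxFrame p) : ℝ :=
  D.kappa 1 - D.kappa 0

end OrientedImmersedSurface

/-- A discrete net on an immersed surface: a cellular decomposition with injective
characteristic maps of closed cells (so that these are homeomorphisms onto the closed cells) such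
that any two closed cells are disjoint or meet in a single closed cell, and such that the edges
(the closed `1`-cells) are smoothly embedded arcs, given here with their (up to reversal unique)
parametrization by arc length. -/
structure DiscreteNet {M : Type*} [TopologicalSpace M] [T2Space M]
    [ChartedSpace (EuclideanSpace ℝ (Fin 2)) M] [IsManifold (𝓡 2) ∞ M]
    (Sg : OrientedImmersedSurface M) where
  [cw : CWComplex (univ : Set M)]
  injOn_map : ∀ (n : ℕ) (i : RelCWComplex.cell (univ : Set M) n),
    InjOn (RelCWComplex.map n i) (closedBall 0 1)
  inter_closedCell : ∀ (n m : ℕ) (i : RelCWComplex.cell (univ : Set M) n)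
    (j : RelCWComplex.cell (univ : Set M) m),
    RelCWComplex.closedCell n i ∩ RelCWComplex.closedCell m j = ∅ ∨
      ∃ (k : ℕ) (l : RelCWComplex.cell (univ : Set M) k),
        RelCWComplex.closedCell n i ∩ RelCWComplex.closedCell m j = RelCWComplex.closedCell k l
  /-- the (intrinsic) length of an edge -/
  len : RelCWComplex.cell (univ : Set M) 1 → ℝ
  /-- the parametrization of an edge by arc length -/
  param : RelCWComplex.cell (univ : Set M) 1 → ℝ → M
  len_pos : ∀ e, 0 < len e
  contMDiffOn_param : ∀ e, ContMDiffOn 𝓘(ℝ, ℝ) (𝓡 2) ∞ (param e) (Icc 0 (len e))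
  injOn_param : ∀ e, InjOn (param e) (Icc 0 (len e))
  image_param : ∀ e, param e '' Icc 0 (len e) = RelCWComplex.closedCell 1 e
  norm_deriv_param : ∀ e, ∀ s ∈ Icc 0 (len e),
    ‖derivWithin (fun t => Sg.imm (param e t)) (Icc 0 (len e)) s‖ = 1

namespace DiscreteNet

variable {M : Type*} [TopologicalSpace M] [T2Space M]
  [ChartedSpace (EuclideanSpace ℝ (Fin 2)) M] [IsManifold (𝓡 2) ∞ M]
  {Sg : OrientedImmersedSurface M} (N : DiscreteNet Sg)

/-- The set of edges of the net. -/
def Edge : Type _ :=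
  letI := N.cw
  RelCWComplex.cell (univ : Set M) 1

/-- The point `p` is a vertex of the net. -/
def IsVertex (p : M) : Prop :=
  letI := N.cw
  ∃ i : RelCWComplex.cell (univ : Set M) 0, RelCWComplex.closedCell 0 i = {p}

/-- The edge `e` emanates from `p`, that is, `p` is one of its two endpoints. -/
def Emanates (e : N.Edge) (p : M) : Prop :=
  N.param e 0 = p ∨ N.param e (N.len e) = p

/-- The valence of `p`: the number of edges emanating from it. -/
noncomputable def valence (p : M) : ℕ := Nat.card {e : N.Edge // N.Emanates e p}

/-- The largest intrinsic length `ε` of the edges emanating from `p`. -/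
noncomputable def maxEdgeLength (p : M) : ℝ := ⨆ e : {e : N.Edge // N.Emanates e p}, N.len e.1

open Classical in
/-- The parametrization by arc length of an edge emanating from `p`, oriented away from `p`. -/
noncomputable def outParam (e : N.Edge) (p : M) : ℝ → M :=
  if N.param e 0 = p then N.param e else fun s => N.param e (N.len e - s)

/-- The straight edge vector of the edge `e` emanating from `p`, pointing away from `p`. -/
noncomputable def edgeVector (e : N.Edge) (p : M) : E3 :=
  Sg.imm (N.outParam e p (N.len e)) - Sg.imm p

/-- The unit tangent vector at `p` of the (curved) edge `e` emanating from `p`. -/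
noncomputable def edgeTangent (e : N.Edge) (p : M) : E3 :=
  derivWithin (fun s => Sg.imm (N.outParam e p s)) (Icc 0 (N.len e)) 0

/-- A discrete net of curvature lines: all edges are segments of curvature lines, that is, all
their tangent vectors are principal directions; non-umbilical vertices have valence four, and
umbilical vertices have valence greater than two. -/
structure IsCurvatureLineNet : Prop where
  principal : ∀ e : N.Edge, ∀ s ∈ Icc 0 (N.len e), Sg.IsPrincipalDirection (N.param e s)
    (derivWithin (fun t => Sg.imm (N.param e t)) (Icc 0 (N.len e)) s)
  valence_eq : ∀ p, N.IsVertex p → ¬ Sg.IsUmbilical p → N.valence p = 4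
  valence_gt : ∀ p, N.IsVertex p → Sg.IsUmbilical p → 2 < N.valence p

/-- The edge `e` emanating from `p` is canonically associated with the principal direction `v i`
of the Darboux frame at `p`: it is a segment of the curvature line through `p` which is tangent
to `v i` there. -/
def IsAssociated (e : N.Edge) {p : M} (D : Sg.DarbouxFrame p) (i : Fin 2) : Prop :=
  N.edgeTangent e p = (D.v i : E3) ∨ N.edgeTangent e p = -(D.v i : E3)

/-- The tangential deviation `e_d` of the edge vector of `e` when `e` is associated with `v i`:
the absolute value of its coordinate along the other one of the two principal directions. -/
noncomputable def tangentialDeviation (e : N.Edge) {p : M} (D : Sg.DarbouxFrame p)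
    (i : Fin 2) : ℝ :=
  |inner ℝ (N.edgeVector e p) (D.v (1 - i) : E3)|

end DiscreteNet

/-! Let `T` be the unit tangent of the edge, `A` the shape operator along it extended by zero to the
normal line, `k` the principal curvature with `A T = k T`, and `v` the other principal direction at
`p`, with curvature `κ`. Since `A 0` is symmetric and `A 0 v = κ v`, ⟨(A s - A 0) T s, v⟩ = (k s -
κ) ⟨T s, v⟩. So a bound on the variation of `A` bounds the `v`-component of `T`, weighted by the
curvature difference.

In ambient space, `A'` has a tangential block, which is ∇S and is bounded by `K'`, and a mixed
block, which differentiating `A n = 0` identifies as `A' n = k² T`. Hence |⟨A' x, y⟩| ≤ K' + K² for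
unit vectors. Replacing `k s` by `k 0` costs another `K' L`, because `k' = ⟨A' T, T⟩`. Integrating
⟨T, v⟩ over the edge gives (K² + 2K') L², which is stronger than the claim.

`abs_sub_mul_inner_le_of_curvatureLine` is this argument for a curve in an inner product space. To
apply it, `contMDiff_ambientDiff` supplies smoothness of the extended shape operator,
`inner_surfaceDiff_normal_comm` its symmetry, and compactness makes the suprema defining the two
bounds finite. Association with exactly one axis is linear algebra at a non-umbilical point
(`eq_or_eq_neg_of_isPrincipalDirection`, `index_unique`). -/

/-! ### The estimate along a curve in an inner product space. -/

section CurvatureLine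

variable {E : Type*} [NormedAddCommGroup E] [InnerProductSpace ℝ E]

/-- Split both vectors into tangential and normal parts. The normal-normal entry of `B` is `k² ⟨T,
n⟩ = 0`, and the mixed entries are `k²` times components along `T`. Their coefficients satisfy `|b|
‖u‖ + |a| ‖w‖ ≤ 1` because `(‖u‖, a)` and `(‖w‖, b)` are unit vectors of the plane. -/
theorem abs_inner_le_of_tangential_bound {B : E →L[ℝ] E} {n T : E} {k K K' : ℝ}
    (hn : ‖n‖ = 1) (hT : ‖T‖ = 1) (hTn : inner ℝ T n = 0)
    (hB : ∀ x y, inner ℝ (B x) y = inner ℝ x (B y)) (hBn : B n = k ^ 2 • T)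
    (hk : |k| ≤ K) (hK' : 0 ≤ K')
    (htan : ∀ x y, inner ℝ x n = 0 → inner ℝ y n = 0 →
      |inner ℝ (B x) y| ≤ K' * ‖x‖ * ‖y‖)
    {x y : E} (hx : ‖x‖ = 1) (hy : ‖y‖ = 1) :
    |inner ℝ (B x) y| ≤ K' + K ^ 2 := by
  have hnn : inner ℝ n n = (1 : ℝ) := by rw [real_inner_self_eq_norm_sq, hn]; norm_num
  have hsplit : ∀ z : E, ‖z‖ = 1 → ∃ (u : E) (a : ℝ), z = u + a • n ∧ inner ℝ u n = 0 ∧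
      ‖u‖ ^ 2 + a ^ 2 = 1 := by
    intro z hz
    have h0 : inner ℝ (z - (inner ℝ z n) • n) n = 0 := by
      rw [inner_sub_left, inner_smul_left, hnn]; simp
    refine ⟨z - (inner ℝ z n) • n, inner ℝ z n, by simp, h0, ?_⟩
    have h1 : ‖(z - (inner ℝ z n) • n) + (inner ℝ z n) • n‖ ^ 2 = 1 := by
      rw [sub_add_cancel, hz]; norm_num
    rw [norm_add_sq_real, inner_smul_right, h0, norm_smul, hn] at h1
    simpa using h1
  obtain ⟨u, a, rfl, hu, hua⟩ := hsplit x hx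
  obtain ⟨w, b, rfl, hw, hwb⟩ := hsplit y hy
  have e1 : inner ℝ (B (u + a • n)) (w + b • n) =
      inner ℝ (B u) w + k ^ 2 * (b * inner ℝ u T + a * inner ℝ T w) := by
    have h1 : inner ℝ (B u) n = k ^ 2 * inner ℝ u T := by
      rw [hB, hBn, inner_smul_right]
    simp only [map_add, map_smul, inner_add_left, inner_add_right, inner_smul_left,
      inner_smul_right, h1, hBn, hTn]
    simp
    ring
  have hu1 : ‖u‖ ≤ 1 := by nlinarith [norm_nonneg u, sq_nonneg a]
  have hw1 : ‖w‖ ≤ 1 := by nlinarith [norm_nonneg w, sq_nonneg b]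
  have h2 : |inner ℝ (B u) w| ≤ K' := (htan u w hu hw).trans (by
    have : K' * ‖u‖ ≤ K' * 1 := by gcongr
    calc K' * ‖u‖ * ‖w‖ ≤ K' * 1 * 1 := by gcongr
      _ = K' := by ring)
  have h3 : |inner ℝ u T| ≤ ‖u‖ := by simpa [hT] using abs_real_inner_le_norm u T
  have h4 : |inner ℝ T w| ≤ ‖w‖ := by simpa [hT] using abs_real_inner_le_norm T w
  have h5 : |b * inner ℝ u T + a * inner ℝ T w| ≤ 1 := by
    calc |b * inner ℝ u T + a * inner ℝ T w| ≤ |b| * ‖u‖ + |a| * ‖w‖ := by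
          refine (abs_add_le _ _).trans ?_
          rw [abs_mul, abs_mul]; gcongr
      _ ≤ 1 := by
          nlinarith [sq_nonneg (|b| - ‖u‖), sq_nonneg (|a| - ‖w‖), sq_abs a, sq_abs b]
  rw [e1]
  refine (abs_add_le _ _).trans (add_le_add h2 ?_)
  rw [abs_mul, abs_pow]
  calc |k| ^ 2 * _ ≤ K ^ 2 * 1 := by gcongr
    _ = K ^ 2 := mul_one _

theorem abs_sub_mul_inner_le_of_curvatureLine {L K K' κ : ℝ} (hL : 0 < L) (hK' : 0 ≤ K')
    {A A' : ℝ → E →L[ℝ] E} {n T T' f : ℝ → E} {k : ℝ → ℝ} {v : E}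
    (hf : ∀ s ∈ Icc 0 L, HasDerivWithinAt f (T s) (Icc 0 L) s)
    (hTd : ∀ s ∈ Icc 0 L, HasDerivWithinAt T (T' s) (Icc 0 L) s)
    (hnd : ∀ s ∈ Icc 0 L, HasDerivWithinAt n (-A s (T s)) (Icc 0 L) s)
    (hAd : ∀ s ∈ Icc 0 L, HasDerivWithinAt A (A' s) (Icc 0 L) s)
    (hA : ∀ s ∈ Icc 0 L, ∀ x y, inner ℝ (A s x) y = inner ℝ x (A s y))
    (hAn : ∀ s ∈ Icc 0 L, A s (n s) = 0)
    (hn : ∀ s ∈ Icc 0 L, ‖n s‖ = 1) (hT : ∀ s ∈ Icc 0 L, ‖T s‖ = 1)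
    (hTn : ∀ s ∈ Icc 0 L, inner ℝ (T s) (n s) = 0)
    (hAT : ∀ s ∈ Icc 0 L, A s (T s) = k s • T s)
    (hAK : ∀ s ∈ Icc 0 L, ‖A s‖ ≤ K)
    (htan : ∀ s ∈ Icc 0 L, ∀ x y, inner ℝ x (n s) = 0 → inner ℝ y (n s) = 0 →
      |inner ℝ (A' s x) y| ≤ K' * ‖x‖ * ‖y‖)
    (hv : ‖v‖ = 1) (hAv : A 0 v = κ • v) :
    |(κ - k 0) * inner ℝ (f L - f 0) v| ≤ (K ^ 2 + 2 * K') * L ^ 2 := by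
  have h0 : (0 : ℝ) ∈ Icc 0 L := ⟨le_rfl, hL.le⟩
  have hLm : L ∈ Icc 0 L := ⟨hL.le, le_rfl⟩
  have hud : UniqueDiffOn ℝ (Icc 0 L) := uniqueDiffOn_Icc hL
  have hpair : ∀ x y, ∀ s ∈ Icc 0 L,
      HasDerivWithinAt (fun t => inner ℝ (A t x) y) (inner ℝ (A' s x) y) (Icc 0 L) s := by
    intro x y s hs
    simpa using ((hAd s hs).clm_apply (hasDerivWithinAt_const s (Icc 0 L) x)).inner ℝ
      (hasDerivWithinAt_const s (Icc 0 L) y)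
  -- Symmetry passes from `A` to `A'` by uniqueness of one-dimensional derivatives within the
  -- interval.
  have hA'symm : ∀ s ∈ Icc 0 L, ∀ x y, inner ℝ (A' s x) y = inner ℝ x (A' s y) := by
    intro s hs x y
    rw [real_inner_comm (A' s y) x]
    refine (hud s hs).eq_deriv _ (hpair x y s hs) ((hpair y x s hs).congr ?_ ?_)
    · intro t ht; rw [hA t ht, real_inner_comm]
    · rw [hA s hs, real_inner_comm]
  -- Differentiating `A n = 0` with `n' = -A T` gives `A' n = A (A T)`.
  have hA'n : ∀ s ∈ Icc 0 L, A' s (n s) = k s ^ 2 • T s := by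
    intro s hs
    have h1 := (hAd s hs).clm_apply (hnd s hs)
    have h2 : HasDerivWithinAt (fun t => A t (n t)) 0 (Icc 0 L) s :=
      (hasDerivWithinAt_const s (Icc 0 L) (0 : E)).congr (fun t ht => hAn t ht) (hAn s hs)
    have h3 := (hud s hs).eq_deriv _ h1 h2
    rw [map_neg, hAT s hs, map_smul, hAT s hs, ← sub_eq_add_neg, sub_eq_zero] at h3
    rw [h3, smul_smul, sq]
  have hkeq : ∀ s ∈ Icc 0 L, k s = inner ℝ (A s (T s)) (T s) := by
    intro s hs
    rw [hAT s hs, inner_smul_left, real_inner_self_eq_norm_sq, hT s hs]; simp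
  have hkK : ∀ s ∈ Icc 0 L, |k s| ≤ K := by
    intro s hs
    have h1 : ‖A s (T s)‖ ≤ K * ‖T s‖ := (A s).le_of_opNorm_le (hAK s hs) _
    rwa [hAT s hs, norm_smul, hT s hs, mul_one, mul_one, Real.norm_eq_abs] at h1
  have hTT' : ∀ s ∈ Icc 0 L, inner ℝ (T' s) (T s) = 0 := by
    intro s hs
    have h1 := (hTd s hs).inner ℝ (hTd s hs)
    have h2 : HasDerivWithinAt (fun t => inner ℝ (T t) (T t)) (0 : ℝ) (Icc 0 L) s := by
      refine (hasDerivWithinAt_const s (Icc 0 L) (1 : ℝ)).congr (fun t ht => ?_) ?_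
      · rw [real_inner_self_eq_norm_sq, hT t ht]; norm_num
      · rw [real_inner_self_eq_norm_sq, hT s hs]; norm_num
    have h3 := (hud s hs).eq_deriv _ h1 h2
    rw [real_inner_comm (T' s) (T s)] at h3
    linarith
  -- Differentiability of `k` comes from `k = ⟨A T, T⟩`; the terms containing `T'` are multiples of
  -- ⟨T', T⟩ = 0.
  have hkd : ∀ s ∈ Icc 0 L, HasDerivWithinAt k (inner ℝ (A' s (T s)) (T s)) (Icc 0 L) s := by
    intro s hs
    have h1 := ((hAd s hs).clm_apply (hTd s hs)).inner ℝ (hTd s hs)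
    refine (h1.congr hkeq (hkeq s hs)).congr_deriv ?_
    have h2 : inner ℝ (A s (T' s)) (T s) = 0 := by
      rw [hA s hs, hAT s hs, inner_smul_right, hTT' s hs, mul_zero]
    have h3 : inner ℝ (A s (T s)) (T' s) = 0 := by
      rw [hA s hs, real_inner_comm, h2]
    rw [inner_add_left, h2, h3, zero_add, add_zero]
  have hkb : ∀ s ∈ Icc 0 L, |k s - k 0| ≤ K' * L := by
    intro s hs
    have h1 := (convex_Icc (0 : ℝ) L).norm_image_sub_le_of_norm_hasDerivWithin_le (C := K') hkd
      (fun t ht => by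
        simpa [hT t ht] using htan t ht (T t) (T t) (hTn t ht) (hTn t ht)) h0 hs
    rw [Real.norm_eq_abs, Real.norm_eq_abs, sub_zero, abs_of_nonneg hs.1] at h1
    exact h1.trans (by gcongr; exact hs.2)
  -- The vectors `T s` and `v` stay frozen while the operator moves from time 0 to `s`. They need
  -- not be tangent at intermediate times, so the bound on `A'` must cover normal components; this
  -- is the source of `K ^ 2`.
  have hAb : ∀ s ∈ Icc 0 L, |inner ℝ (A s (T s)) v - inner ℝ (A 0 (T s)) v| ≤
      (K' + K ^ 2) * L := by
    intro s hs
    have h1 := (convex_Icc (0 : ℝ) L).norm_image_sub_le_of_norm_hasDerivWithin_le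
      (C := K' + K ^ 2) (hpair (T s) v)
      (fun t ht => abs_inner_le_of_tangential_bound (hn t ht) (hT t ht) (hTn t ht)
        (hA'symm t ht) (hA'n t ht) (hkK t ht) hK' (htan t ht) (hT s hs) hv) h0 hs
    rw [Real.norm_eq_abs, Real.norm_eq_abs, sub_zero, abs_of_nonneg hs.1] at h1
    exact h1.trans (by gcongr; exact hs.2)
  have hfb : ∀ s ∈ Icc 0 L, |(κ - k 0) * inner ℝ (T s) v| ≤ (K ^ 2 + 2 * K') * L := by
    intro s hs
    -- `A 0` is moved onto its eigenvector `v`.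
    have h1 : inner ℝ (A s (T s)) v - inner ℝ (A 0 (T s)) v = (k s - κ) * inner ℝ (T s) v := by
      rw [hAT s hs, hA 0 h0, hAv, inner_smul_left, inner_smul_right]; simp; ring
    have h2 := hAb s hs
    rw [h1] at h2
    have h3 : |inner ℝ (T s) v| ≤ 1 := by
      simpa [hT s hs, hv] using abs_real_inner_le_norm (T s) v
    have h4 : |(k s - k 0) * inner ℝ (T s) v| ≤ K' * L * 1 := by
      rw [abs_mul]
      have := hkb s hs
      gcongr
    calc |(κ - k 0) * inner ℝ (T s) v|
        = |(k s - k 0) * inner ℝ (T s) v - (k s - κ) * inner ℝ (T s) v| := by ring_nf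
      _ ≤ K' * L * 1 + (K' + K ^ 2) * L := (abs_sub _ _).trans (add_le_add h4 h2)
      _ = (K ^ 2 + 2 * K') * L := by ring
  have hfd : ∀ s ∈ Icc 0 L, HasDerivWithinAt (fun t => (κ - k 0) * inner ℝ (f t) v)
      ((κ - k 0) * inner ℝ (T s) v) (Icc 0 L) s := by
    intro s hs
    have := ((hf s hs).inner ℝ (hasDerivWithinAt_const s (Icc 0 L) v)).const_mul (κ - k 0)
    simpa using this
  have h1 := (convex_Icc (0 : ℝ) L).norm_image_sub_le_of_norm_hasDerivWithin_le hfd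
    (fun t ht => hfb t ht) h0 hLm
  rw [Real.norm_eq_abs, Real.norm_eq_abs, sub_zero, abs_of_nonneg hL.le, ← mul_sub,
    ← inner_sub_left] at h1
  calc _ ≤ _ := h1
    _ = _ := by ring

end CurvatureLine

/-! ### Reduction of differentials on the surface to calculus in a chart. -/

section Chart

variable {M : Type*} [TopologicalSpace M] [ChartedSpace (EuclideanSpace ℝ (Fin 2)) M]

/-- The derivative of the inverse of the chart at `p₀`. -/
noncomputable def chartSymmDeriv (p₀ : M) (x : EuclideanSpace ℝ (Fin 2)) :
    EuclideanSpace ℝ (Fin 2) →L[ℝ] TangentSpace (𝓡 2) ((extChartAt (𝓡 2) p₀).symm x) :=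
  mfderiv 𝓘(ℝ, EuclideanSpace ℝ (Fin 2)) (𝓡 2) (extChartAt (𝓡 2) p₀).symm x

variable [IsManifold (𝓡 2) ∞ M] {p₀ : M} {x : EuclideanSpace ℝ (Fin 2)}

theorem chartSymmDeriv_bijective (hx : x ∈ (extChartAt (𝓡 2) p₀).target) :
    Function.Bijective (chartSymmDeriv p₀ x) := by
  have : IsManifold (𝓡 2) 1 M := IsManifold.of_le (n := ∞) (by simp)
  have h := isInvertible_mfderivWithin_extChartAt_symm (I := 𝓡 2) hx
  rw [ModelWithCorners.Boundaryless.range_eq_univ, mfderivWithin_univ] at h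
  exact h.bijective

variable {F : Type*} [NormedAddCommGroup F] [NormedSpace ℝ F]

theorem hasFDerivAt_comp_chart_symm {g : M → F} (hg : ContMDiff (𝓡 2) 𝓘(ℝ, F) ∞ g)
    (hx : x ∈ (extChartAt (𝓡 2) p₀).target) :
    HasFDerivAt (fun y => g ((extChartAt (𝓡 2) p₀).symm y))
      ((surfaceDiff g ((extChartAt (𝓡 2) p₀).symm x)).comp (chartSymmDeriv p₀ x)) x := by
  refine hasMFDerivAt_iff_hasFDerivAt.1 ?_
  have h1 : ContMDiffAt 𝓘(ℝ, EuclideanSpace ℝ (Fin 2)) (𝓡 2) ∞ (extChartAt (𝓡 2) p₀).symm x :=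
    (contMDiffOn_extChartAt_symm p₀).contMDiffAt (extChartAt_target_mem_nhds' hx)
  exact ((hg _).mdifferentiableAt (by simp)).hasMFDerivAt.comp x
    (h1.mdifferentiableAt (by simp)).hasMFDerivAt

theorem contDiffAt_comp_chart_symm {g : M → F} (hg : ContMDiff (𝓡 2) 𝓘(ℝ, F) ∞ g)
    (hx : x ∈ (extChartAt (𝓡 2) p₀).target) :
    ContDiffAt ℝ ∞ (fun y => g ((extChartAt (𝓡 2) p₀).symm y)) x := by
  have h1 : ContMDiffAt 𝓘(ℝ, EuclideanSpace ℝ (Fin 2)) (𝓡 2) ∞ (extChartAt (𝓡 2) p₀).symm x :=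
    (contMDiffOn_extChartAt_symm p₀).contMDiffAt (extChartAt_target_mem_nhds' hx)
  exact ((hg _).comp x h1).contDiffAt

end Chart

/-! ### Differentials extended to ambient space, and symmetry of the second fundamental form. -/

namespace OrientedImmersedSurface

variable {M : Type*} [TopologicalSpace M] [ChartedSpace (EuclideanSpace ℝ (Fin 2)) M]
  [IsManifold (𝓡 2) ∞ M] (Sg : OrientedImmersedSurface M)
  {F : Type*} [NormedAddCommGroup F] [NormedSpace ℝ F]

/-- The differential at `q` of a function on the surface, as a linear map on Euclidean space
which vanishes on the normal line. -/
noncomputable def ambientDiff (g : M → F) (q : M) : E3 →L[ℝ] F :=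
  LinearMap.toContinuousLinearMap
    { toFun := fun x => Sg.dirDeriv g q (Sg.proj q x)
      map_add' := fun x y => by rw [map_add, dirDeriv_add]
      map_smul' := fun c x => by rw [map_smul, dirDeriv_smul, RingHom.id_apply] }

theorem ambientDiff_apply (g : M → F) (q : M) (x : E3) :
    Sg.ambientDiff g q x = Sg.dirDeriv g q (Sg.proj q x) := rfl

theorem proj_coe (q : M) (v : Sg.tangentPlane q) : Sg.proj q (v : E3) = v := by
  simp [proj]

theorem ambientDiff_coe (g : M → F) (q : M) (v : Sg.tangentPlane q) :
    Sg.ambientDiff g q (v : E3) = Sg.dirDeriv g q v := by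
  rw [ambientDiff_apply, proj_coe]

theorem ambientDiff_surfaceDiff (g : M → F) (q : M) (ξ : TangentSpace (𝓡 2) q) :
    Sg.ambientDiff g q (surfaceDiff Sg.imm q ξ) = surfaceDiff g q ξ := by
  have h : surfaceDiff Sg.imm q ξ = (Sg.tangentEquiv q ξ : E3) := rfl
  rw [h, ambientDiff_coe, dirDeriv, LinearEquiv.symm_apply_apply]

theorem inner_coe_normal (q : M) (v : Sg.tangentPlane q) : inner ℝ (v : E3) (Sg.normal q) = 0 := by
  obtain ⟨ξ, hξ⟩ := v.2
  rw [← hξ]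
  exact Sg.normal_orthogonal q ξ

theorem proj_normal (q : M) : Sg.proj q (Sg.normal q) = 0 := by
  rw [proj, Submodule.orthogonalProjectionOnto_eq_zero_iff, Submodule.mem_orthogonal]
  exact fun u hu => Sg.inner_coe_normal q ⟨u, hu⟩

theorem ambientDiff_normal (g : M → F) (q : M) : Sg.ambientDiff g q (Sg.normal q) = 0 := by
  rw [ambientDiff_apply, proj_normal, ← zero_smul ℝ (0 : Sg.tangentPlane q), dirDeriv_smul,
    zero_smul]

theorem inner_normal_normal (q : M) : inner ℝ (Sg.normal q) (Sg.normal q) = (1 : ℝ) := by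
  rw [real_inner_self_eq_norm_sq, Sg.norm_normal]; norm_num

/-- Pairing with the normal kills the tangential part, so injectivity splits; dimensions 2 + 1 = 3
do the rest. The parameter `J` allows both the identity and the derivative of an inverse chart. -/
theorem surfaceDiff_coprod_normal_bijective (q : M)
    {J : EuclideanSpace ℝ (Fin 2) →L[ℝ] TangentSpace (𝓡 2) q} (hJ : Function.Injective J) :
    Function.Bijective
      (fun z : EuclideanSpace ℝ (Fin 2) × ℝ => surfaceDiff Sg.imm q (J z.1) + z.2 • Sg.normal q) := by
  let L : EuclideanSpace ℝ (Fin 2) × ℝ →ₗ[ℝ] E3 :=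
    ((surfaceDiff Sg.imm q).comp J).toLinearMap.coprod (LinearMap.toSpanSingleton ℝ E3 (Sg.normal q))
  have hL : ⇑L = fun z => surfaceDiff Sg.imm q (J z.1) + z.2 • Sg.normal q := rfl
  have hinj : Function.Injective L := by
    rw [injective_iff_map_eq_zero]
    rintro ⟨a, t⟩ h
    rw [hL] at h
    have ht : t = 0 := by
      have := congrArg (fun y => inner ℝ y (Sg.normal q)) h
      simpa [inner_add_left, inner_smul_left, Sg.normal_orthogonal, Sg.norm_normal] using this
    subst ht
    have ha : surfaceDiff Sg.imm q (J a) = 0 := by simpa using h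
    have : J a = 0 := Sg.injective_differential q (by rw [ha, map_zero])
    rw [hJ (this.trans (map_zero J).symm)]
    rfl
  rw [← hL]
  refine ⟨hinj, (LinearMap.injective_iff_surjective_of_finrank_eq_finrank ?_).1 hinj⟩
  simp

theorem eq_add_smul_normal (q : M) (x : E3) :
    x = (Sg.proj q x : E3) + inner ℝ x (Sg.normal q) • Sg.normal q := by
  obtain ⟨⟨a, t⟩, rfl⟩ := (Sg.surfaceDiff_coprod_normal_bijective q
    (J := ContinuousLinearMap.id ℝ (EuclideanSpace ℝ (Fin 2))) Function.injective_id).2 x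
  have h : ∀ ξ, surfaceDiff Sg.imm q ξ = (Sg.tangentEquiv q ξ : E3) := fun _ => rfl
  simp only [h, map_add, map_smul, proj_coe, proj_normal, inner_add_left, inner_smul_left,
    inner_coe_normal, inner_normal_normal]
  simp

/-- The definition uses projections onto varying planes, whose smoothness is not visible. In a
chart, however, composing with the invertible map `L = (df, n)` gives `dG` on the first factor and
zero on the second, and inversion of operators is smooth. -/
theorem contMDiff_ambientDiff {g : M → F} (hg : ContMDiff (𝓡 2) 𝓘(ℝ, F) ∞ g) :
    ContMDiff (𝓡 2) 𝓘(ℝ, E3 →L[ℝ] F) ∞ (Sg.ambientDiff g) := by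
  intro p₀
  let φ := extChartAt (𝓡 2) p₀
  let G : EuclideanSpace ℝ (Fin 2) → F := fun y => g (φ.symm y)
  let f : EuclideanSpace ℝ (Fin 2) → E3 := fun y => Sg.imm (φ.symm y)
  let n : EuclideanSpace ℝ (Fin 2) → E3 := fun y => Sg.normal (φ.symm y)
  let L : EuclideanSpace ℝ (Fin 2) → (EuclideanSpace ℝ (Fin 2) × ℝ →L[ℝ] E3) := fun y =>
    (fderiv ℝ f y).comp (ContinuousLinearMap.fst ℝ _ _) +
      (ContinuousLinearMap.snd ℝ (EuclideanSpace ℝ (Fin 2)) ℝ).smulRight (n y)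
  let H : EuclideanSpace ℝ (Fin 2) → (E3 →L[ℝ] F) := fun y =>
    ((fderiv ℝ G y).comp (ContinuousLinearMap.fst ℝ _ _)).comp (L y).inverse
  have hLe : ∀ y ∈ φ.target, ∃ e : (EuclideanSpace ℝ (Fin 2) × ℝ) ≃L[ℝ] E3,
      (e : EuclideanSpace ℝ (Fin 2) × ℝ →L[ℝ] E3) = L y := by
    intro y hy
    have hb : Function.Bijective (L y) := by
      have h1 := Sg.surfaceDiff_coprod_normal_bijective (φ.symm y)
        (chartSymmDeriv_bijective hy).1
      have h2 : fderiv ℝ f y = _ := (hasFDerivAt_comp_chart_symm Sg.contMDiff_imm hy).fderiv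
      have h3 : ⇑(L y) = fun z => surfaceDiff Sg.imm (φ.symm y) (chartSymmDeriv p₀ y z.1) +
          z.2 • Sg.normal (φ.symm y) := by
        funext z
        simp only [L, h2]
        rfl
      rw [h3]; exact h1
    refine ⟨ContinuousLinearEquiv.ofBijective (L y) (LinearMap.ker_eq_bot.2 hb.1)
      (LinearMap.range_eq_top.2 hb.2), ?_⟩
    ext z <;> simp
  have hHeq : ∀ q ∈ φ.source, Sg.ambientDiff g q = H (φ q) := by
    intro q hq
    have hy : φ q ∈ φ.target := φ.map_source hq
    obtain ⟨y, hyq⟩ : ∃ y, φ q = y := ⟨_, rfl⟩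
    obtain rfl : φ.symm y = q := by rw [← hyq, φ.left_inv hq]
    rw [hyq] at hy ⊢
    obtain ⟨e, he⟩ := hLe y hy
    have h2 : fderiv ℝ f y = _ := (hasFDerivAt_comp_chart_symm Sg.contMDiff_imm hy).fderiv
    have h2' : fderiv ℝ G y = _ := (hasFDerivAt_comp_chart_symm hg hy).fderiv
    have h3 : (Sg.ambientDiff g (φ.symm y)).comp (L y) =
        (fderiv ℝ G y).comp (ContinuousLinearMap.fst ℝ _ _) := by
      refine ContinuousLinearMap.ext fun z => ?_
      have h4 : L y z = surfaceDiff Sg.imm (φ.symm y) (chartSymmDeriv p₀ y z.1) +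
          z.2 • Sg.normal (φ.symm y) := by
        simp only [L, h2]
        rfl
      rw [ContinuousLinearMap.comp_apply, h4, map_add, map_smul, ambientDiff_normal, smul_zero,
        add_zero, ambientDiff_surfaceDiff, h2']
      rfl
    have h5 : H y = ((Sg.ambientDiff g (φ.symm y)).comp (L y)).comp (L y).inverse := by
      rw [h3]
    rw [h5, ← he, ContinuousLinearMap.inverse_equiv]
    ext x
    simp
  have hp : φ p₀ ∈ φ.target := φ.map_source (mem_extChartAt_source p₀)
  have hH : ContDiffAt ℝ ∞ H (φ p₀) := by
    have hf' : ContDiffAt ℝ ∞ (fderiv ℝ f) (φ p₀) :=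
      (contDiffAt_comp_chart_symm Sg.contMDiff_imm hp).fderiv_right (m := ∞) (by simp)
    have hG' : ContDiffAt ℝ ∞ (fderiv ℝ G) (φ p₀) :=
      (contDiffAt_comp_chart_symm hg hp).fderiv_right (m := ∞) (by simp)
    have hn : ContDiffAt ℝ ∞ n (φ p₀) := contDiffAt_comp_chart_symm Sg.contMDiff_normal hp
    have hL : ContDiffAt ℝ ∞ L (φ p₀) :=
      (hf'.clm_comp contDiffAt_const).add (contDiffAt_const.smulRight hn)
    obtain ⟨e, he⟩ := hLe _ hp
    have hinv : ContDiffAt ℝ ∞ (ContinuousLinearMap.inverse (R := ℝ)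
        (M := EuclideanSpace ℝ (Fin 2) × ℝ) (M₂ := E3)) (L (φ p₀)) := by
      rw [← he]; exact contDiffAt_map_inverse e
    exact (hG'.clm_comp contDiffAt_const).clm_comp (hinv.comp (φ p₀) hL)
  have hcomp : ContMDiffAt (𝓡 2) 𝓘(ℝ, E3 →L[ℝ] F) ∞ (fun q => H (φ q)) p₀ :=
    hH.contMDiffAt.comp p₀ contMDiffAt_extChartAt
  refine hcomp.congr_of_eventuallyEq ?_
  filter_upwards [extChartAt_source_mem_nhds (I := 𝓡 2) p₀] with q hq using hHeq q hq

/-- The second fundamental form is symmetric. -/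
theorem inner_surfaceDiff_normal_comm (q : M) (ξ η : TangentSpace (𝓡 2) q) :
    inner ℝ (surfaceDiff Sg.imm q ξ) (surfaceDiff Sg.normal q η) =
      inner ℝ (surfaceDiff Sg.imm q η) (surfaceDiff Sg.normal q ξ) := by
  obtain ⟨p₀, x, hx, rfl⟩ : ∃ (p₀ : M) (x : EuclideanSpace ℝ (Fin 2)),
      x ∈ (extChartAt (𝓡 2) p₀).target ∧ (extChartAt (𝓡 2) p₀).symm x = q :=
    ⟨q, extChartAt (𝓡 2) q q, (extChartAt (𝓡 2) q).map_source (mem_extChartAt_source q),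
      (extChartAt (𝓡 2) q).left_inv (mem_extChartAt_source q)⟩
  let φ := extChartAt (𝓡 2) p₀
  let f : EuclideanSpace ℝ (Fin 2) → E3 := fun y => Sg.imm (φ.symm y)
  let n : EuclideanSpace ℝ (Fin 2) → E3 := fun y => Sg.normal (φ.symm y)
  have hf : ContDiffAt ℝ ∞ f x := contDiffAt_comp_chart_symm Sg.contMDiff_imm hx
  have hn : ContDiffAt ℝ ∞ n x := contDiffAt_comp_chart_symm Sg.contMDiff_normal hx
  have hsym : IsSymmSndFDerivAt ℝ f x := hf.isSymmSndFDerivAt (by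
    rw [minSmoothness_of_isRCLikeNormedField]; exact WithTop.coe_le_coe.2 (le_top : (2 : ℕ∞) ≤ ⊤))
  have hf' : HasFDerivAt (fderiv ℝ f) (fderiv ℝ (fderiv ℝ f) x) x :=
    ((hf.fderiv_right (m := ∞) (by simp)).differentiableAt (by simp)).hasFDerivAt
  have hn' : HasFDerivAt n (fderiv ℝ n x) x := (hn.differentiableAt (by simp)).hasFDerivAt
  -- Differentiate ⟨df a, n⟩ = 0 in direction `b`; the right-hand side is symmetric in `a` and `b`
  -- by equality of mixed second derivatives.
  have key : ∀ a b, inner ℝ (fderiv ℝ f x a) (fderiv ℝ n x b) =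
      -inner ℝ (fderiv ℝ (fderiv ℝ f) x b a) (n x) := by
    intro a b
    have h1 := (hf'.clm_apply (hasFDerivAt_const a x)).inner ℝ hn'
    have h2 : HasFDerivAt (fun y => inner ℝ (fderiv ℝ f y a) (n y))
        (0 : EuclideanSpace ℝ (Fin 2) →L[ℝ] ℝ) x := by
      refine (hasFDerivAt_const (0 : ℝ) x).congr_of_eventuallyEq ?_
      filter_upwards [(isOpen_extChartAt_target (I := 𝓡 2) p₀).mem_nhds hx] with y hy
      have h3 : fderiv ℝ f y = _ := (hasFDerivAt_comp_chart_symm Sg.contMDiff_imm hy).fderiv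
      rw [h3]
      exact Sg.normal_orthogonal _ _
    have h4 := congrArg (fun l : EuclideanSpace ℝ (Fin 2) →L[ℝ] ℝ => l b) (h1.unique h2)
    simp at h4
    linarith
  have hf3 : fderiv ℝ f x = _ := (hasFDerivAt_comp_chart_symm Sg.contMDiff_imm hx).fderiv
  have hn3 : fderiv ℝ n x = _ := (hasFDerivAt_comp_chart_symm Sg.contMDiff_normal hx).fderiv
  obtain ⟨a, rfl⟩ := (chartSymmDeriv_bijective hx).2 ξ
  obtain ⟨b, rfl⟩ := (chartSymmDeriv_bijective hx).2 η
  have h5 := key a b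
  have h6 := key b a
  rw [hsym a b, ← h5, hf3, hn3] at h6
  exact h6.symm

end OrientedImmersedSurface

/-! ### The chain rule along a curve, and boundedness on a compact surface. -/

theorem hasDerivWithinAt_comp_curve_mfderivWithin {M : Type*} [TopologicalSpace M]
    [ChartedSpace (EuclideanSpace ℝ (Fin 2)) M] {F : Type*} [NormedAddCommGroup F]
    [NormedSpace ℝ F] {L : ℝ} {c : ℝ → M} (hc : ContMDiffOn 𝓘(ℝ, ℝ) (𝓡 2) ∞ c (Icc 0 L)) {g : M → F}
    (hg : ContMDiff (𝓡 2) 𝓘(ℝ, F) ∞ g) {s : ℝ} (hs : s ∈ Icc 0 L) :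
    HasDerivWithinAt (fun t => g (c t))
      (surfaceDiff g (c s) (mfderivWithin 𝓘(ℝ, ℝ) (𝓡 2) c (Icc 0 L) s (1 : ℝ))) (Icc 0 L) s := by
  have h1 : HasFDerivWithinAt (fun t => g (c t)) ((surfaceDiff g (c s)).comp
      (mfderivWithin 𝓘(ℝ, ℝ) (𝓡 2) c (Icc 0 L) s) : ℝ →L[ℝ] F) (Icc 0 L) s :=
    hasMFDerivWithinAt_iff_hasFDerivWithinAt.1
      (((hg _).mdifferentiableAt (by simp)).hasMFDerivAt.comp_hasMFDerivWithinAt s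
        ((hc s hs).mdifferentiableWithinAt (by simp)).hasMFDerivWithinAt)
  exact h1.hasDerivWithinAt

theorem exists_norm_le_of_continuous {M : Type*} [TopologicalSpace M] [CompactSpace M]
    {F : Type*} [SeminormedAddGroup F] {g : M → F} (hg : Continuous g) :
    ∃ C : ℝ, 0 ≤ C ∧ ∀ q, ‖g q‖ ≤ C := by
  obtain ⟨C, hC⟩ := (isCompact_univ (X := M)).exists_bound_of_continuousOn hg.continuousOn
  exact ⟨max C 0, le_max_right _ _, fun q => (hC q (mem_univ q)).trans (le_max_left _ _)⟩

/-! ### The extended shape operator and its bounds. -/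

namespace OrientedImmersedSurface

variable {M : Type*} [TopologicalSpace M] [ChartedSpace (EuclideanSpace ℝ (Fin 2)) M]
  [IsManifold (𝓡 2) ∞ M] (Sg : OrientedImmersedSurface M)
  {F : Type*} [NormedAddCommGroup F] [NormedSpace ℝ F]

theorem inner_surfaceDiff_normal_normal (q : M) (ξ : TangentSpace (𝓡 2) q) :
    inner ℝ (surfaceDiff Sg.normal q ξ) (Sg.normal q) = 0 := by
  obtain ⟨p₀, x, hx, rfl⟩ : ∃ (p₀ : M) (x : EuclideanSpace ℝ (Fin 2)),
      x ∈ (extChartAt (𝓡 2) p₀).target ∧ (extChartAt (𝓡 2) p₀).symm x = q :=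
    ⟨q, extChartAt (𝓡 2) q q, (extChartAt (𝓡 2) q).map_source (mem_extChartAt_source q),
      (extChartAt (𝓡 2) q).left_inv (mem_extChartAt_source q)⟩
  obtain ⟨a, rfl⟩ := (chartSymmDeriv_bijective hx).2 ξ
  have h := hasFDerivAt_comp_chart_symm Sg.contMDiff_normal hx
  have h1 := h.inner ℝ h
  have h2 : HasFDerivAt (fun y => inner ℝ (Sg.normal ((extChartAt (𝓡 2) p₀).symm y))
      (Sg.normal ((extChartAt (𝓡 2) p₀).symm y))) (0 : EuclideanSpace ℝ (Fin 2) →L[ℝ] ℝ) x :=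
    (hasFDerivAt_const (1 : ℝ) x).congr_of_eventuallyEq
      (Filter.Eventually.of_forall fun y => Sg.inner_normal_normal _)
  have h4 : inner ℝ (Sg.normal ((extChartAt (𝓡 2) p₀).symm x))
      (surfaceDiff Sg.normal _ (chartSymmDeriv p₀ x a)) +
      inner ℝ (surfaceDiff Sg.normal _ (chartSymmDeriv p₀ x a))
        (Sg.normal ((extChartAt (𝓡 2) p₀).symm x)) = (0 : ℝ) :=
    congrArg (fun l : EuclideanSpace ℝ (Fin 2) →L[ℝ] ℝ => l a) (h1.unique h2)
  rw [real_inner_comm] at h4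
  linarith

theorem coe_proj_of_inner_eq_zero {q : M} {x : E3} (hx : inner ℝ x (Sg.normal q) = 0) :
    (Sg.proj q x : E3) = x := by
  have h := Sg.eq_add_smul_normal q x
  rw [hx, zero_smul, add_zero] at h
  exact h.symm

theorem inner_coe_proj (q : M) (x : E3) (u : Sg.tangentPlane q) :
    inner ℝ (Sg.proj q x) u = inner ℝ x (u : E3) := by
  conv_rhs => rw [Sg.eq_add_smul_normal q x]
  rw [inner_add_left, inner_smul_left, real_inner_comm (u : E3) (Sg.normal q),
    inner_coe_normal, mul_zero, add_zero, Submodule.coe_inner]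

theorem norm_proj_le (q : M) (x : E3) : ‖Sg.proj q x‖ ≤ ‖x‖ :=
  Submodule.norm_orthogonalProjectionOnto_apply_le _ x

theorem inner_ambientDiff_normal_normal (q : M) (x : E3) :
    inner ℝ (Sg.ambientDiff Sg.normal q x) (Sg.normal q) = 0 :=
  Sg.inner_surfaceDiff_normal_normal q _

/-- The field of shape operators, extended by zero to the normal lines. -/
noncomputable def ambientShape (q : M) : E3 →L[ℝ] E3 := Sg.extendEnd q (Sg.shapeOperator q)

theorem ambientShape_apply (q : M) (x : E3) :
    Sg.ambientShape q x = (Sg.shapeOperator q (Sg.proj q x) : E3) := rfl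

theorem ambientShape_coe (q : M) (v : Sg.tangentPlane q) :
    Sg.ambientShape q (v : E3) = (Sg.shapeOperator q v : E3) := by
  rw [ambientShape_apply, proj_coe]

/-- The derivative of the unit normal is already tangential, so the projection in `shapeOperator`
changes nothing. Smoothness of the field follows from this form. -/
theorem ambientShape_eq : Sg.ambientShape = fun q => -Sg.ambientDiff Sg.normal q := by
  funext q
  ext1 x
  have h : Sg.ambientShape q x = -(Sg.proj q (Sg.ambientDiff Sg.normal q x) : E3) := rfl
  rw [h, Sg.coe_proj_of_inner_eq_zero (Sg.inner_ambientDiff_normal_normal q x)]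
  rfl

theorem contMDiff_ambientShape : ContMDiff (𝓡 2) 𝓘(ℝ, E3 →L[ℝ] E3) ∞ Sg.ambientShape := by
  rw [ambientShape_eq]
  exact contDiff_neg.contMDiff.comp (Sg.contMDiff_ambientDiff Sg.contMDiff_normal)

theorem ambientShape_normal (q : M) : Sg.ambientShape q (Sg.normal q) = 0 := by
  rw [ambientShape_apply, proj_normal, map_zero, Submodule.coe_zero]

theorem inner_ambientShape_comm (q : M) (x y : E3) :
    inner ℝ (Sg.ambientShape q x) y = inner ℝ x (Sg.ambientShape q y) := by
  have key : ∀ x y : E3, inner ℝ (Sg.ambientShape q x) y =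
      -inner ℝ (surfaceDiff Sg.normal q ((Sg.tangentEquiv q).symm (Sg.proj q x)))
        (surfaceDiff Sg.imm q ((Sg.tangentEquiv q).symm (Sg.proj q y))) := by
    intro x y
    have h1 : Sg.ambientShape q x =
        -surfaceDiff Sg.normal q ((Sg.tangentEquiv q).symm (Sg.proj q x)) := by
      rw [ambientShape_eq]; rfl
    have h2 : surfaceDiff Sg.imm q ((Sg.tangentEquiv q).symm (Sg.proj q y)) =
        (Sg.proj q y : E3) :=
      congrArg Subtype.val ((Sg.tangentEquiv q).apply_symm_apply (Sg.proj q y))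
    rw [h1, h2]
    conv_lhs => rw [Sg.eq_add_smul_normal q y]
    rw [inner_add_right, inner_smul_right, inner_neg_left, inner_neg_left,
      inner_surfaceDiff_normal_normal]
    simp
  rw [key, real_inner_comm (Sg.ambientShape q y) x, key, real_inner_comm,
    Sg.inner_surfaceDiff_normal_comm]
  rw [real_inner_comm]

theorem coe_nablaShape (q : M) (v u : Sg.tangentPlane q) :
    Sg.nablaShape q v u = Sg.proj q (Sg.ambientDiff Sg.ambientShape q (v : E3) (u : E3)) := by
  rw [ambientDiff_coe]; rfl

/-- The right-hand side is continuous in `q`, hence bounded on a compact surface; this makes the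
suprema in `curvatureDerivBound` genuine ones. -/
theorem norm_nablaShape_le (q : M) (v : Sg.tangentPlane q) (hv : ‖v‖ = 1) :
    ‖Sg.nablaShape q v‖ ≤ ‖Sg.ambientDiff Sg.ambientShape q‖ := by
  refine ContinuousLinearMap.opNorm_le_bound _ (norm_nonneg _) fun u => ?_
  rw [coe_nablaShape]
  refine (Sg.norm_proj_le q _).trans ?_
  have h := (Sg.ambientDiff Sg.ambientShape q (v : E3)).le_opNorm (u : E3)
  have h2 := (Sg.ambientDiff Sg.ambientShape q).le_opNorm (v : E3)
  rw [← Submodule.coe_norm, hv, mul_one] at h2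
  exact h.trans (by gcongr; rfl)

theorem norm_shapeOperator_le_norm_ambientShape (q : M) :
    ‖Sg.shapeOperator q‖ ≤ ‖Sg.ambientShape q‖ := by
  refine ContinuousLinearMap.opNorm_le_bound _ (norm_nonneg _) fun u => ?_
  rw [Submodule.coe_norm, ← ambientShape_coe]
  exact (Sg.ambientShape q).le_opNorm (u : E3)

theorem norm_ambientShape_le_norm_shapeOperator (q : M) :
    ‖Sg.ambientShape q‖ ≤ ‖Sg.shapeOperator q‖ := by
  refine ContinuousLinearMap.opNorm_le_bound _ (ContinuousLinearMap.opNorm_nonneg _) fun x => ?_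
  rw [ambientShape_apply, ← Submodule.coe_norm]
  refine ((Sg.shapeOperator q).le_opNorm _).trans ?_
  gcongr
  exact Sg.norm_proj_le q x

theorem curvatureDerivBound_nonneg : 0 ≤ Sg.curvatureDerivBound :=
  Real.iSup_nonneg fun _ => Real.iSup_nonneg fun _ =>
    ContinuousLinearMap.opNorm_nonneg _

section Compact

variable [CompactSpace M]

theorem norm_ambientShape_le_curvatureBound (q : M) :
    ‖Sg.ambientShape q‖ ≤ Sg.curvatureBound := by
  obtain ⟨C, -, hC⟩ := exists_norm_le_of_continuous Sg.contMDiff_ambientShape.continuous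
  refine (Sg.norm_ambientShape_le_norm_shapeOperator q).trans
    (le_ciSup (f := fun p => ‖Sg.shapeOperator p‖) ⟨C, ?_⟩ q)
  rintro _ ⟨p, rfl⟩
  exact (Sg.norm_shapeOperator_le_norm_ambientShape p).trans (hC p)

theorem norm_nablaShape_le_curvatureDerivBound (q : M) (v : Sg.tangentPlane q) (hv : ‖v‖ = 1) :
    ‖Sg.nablaShape q v‖ ≤ Sg.curvatureDerivBound := by
  obtain ⟨C, hC0, hC⟩ := exists_norm_le_of_continuous
    (Sg.contMDiff_ambientDiff Sg.contMDiff_ambientShape).continuous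
  have hb : ∀ (p : M) (w : sphere (0 : Sg.tangentPlane p) 1), ‖Sg.nablaShape p w‖ ≤ C :=
    fun p w => (Sg.norm_nablaShape_le p w (by simp)).trans (hC p)
  refine (le_ciSup (f := fun w : sphere (0 : Sg.tangentPlane q) 1 => ‖Sg.nablaShape q w‖)
    ⟨C, ?_⟩ ⟨v, by simp [hv]⟩).trans (le_ciSup (f := fun p =>
      ⨆ w : sphere (0 : Sg.tangentPlane p) 1, ‖Sg.nablaShape p w‖) ⟨C, ?_⟩ q)
  · rintro _ ⟨w, rfl⟩
    exact hb q w
  · rintro _ ⟨p, rfl⟩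
    -- Nonnegativity of `C` covers the default value 0 of an empty supremum, so no unit vector has
    -- to be exhibited.
    exact Real.iSup_le (hb p) hC0

theorem abs_inner_ambientDiff_ambientShape_le (q : M) (v : Sg.tangentPlane q) (hv : ‖v‖ = 1)
    {x y : E3} (hx : inner ℝ x (Sg.normal q) = 0) (hy : inner ℝ y (Sg.normal q) = 0) :
    |inner ℝ (Sg.ambientDiff Sg.ambientShape q (v : E3) x) y| ≤
      Sg.curvatureDerivBound * ‖x‖ * ‖y‖ := by
  have h1 : inner ℝ (Sg.ambientDiff Sg.ambientShape q (v : E3) x) y =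
      inner ℝ (Sg.nablaShape q v (Sg.proj q x)) (Sg.proj q y) := by
    rw [coe_nablaShape, inner_coe_proj, Sg.coe_proj_of_inner_eq_zero hx,
      Sg.coe_proj_of_inner_eq_zero hy]
  rw [h1]
  refine (abs_real_inner_le_norm _ _).trans ?_
  have h2 := Sg.norm_nablaShape_le_curvatureDerivBound q v hv
  have h3 := (Sg.nablaShape q v).le_of_opNorm_le h2 (Sg.proj q x)
  have h0 := Sg.curvatureDerivBound_nonneg
  calc _ ≤ (Sg.curvatureDerivBound * ‖Sg.proj q x‖) * ‖Sg.proj q y‖ := by gcongr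
    _ ≤ _ := by
      gcongr
      · exact Sg.norm_proj_le q x
      · exact Sg.norm_proj_le q y

end Compact

/-! ### The estimate for an arc of a curvature line on the surface. -/

section Curve

variable {L : ℝ} {c : ℝ → M}

/-- Expresses every derivative along the curve through the velocity of its image in Euclidean space,
the `T` of the abstract estimate. -/
theorem hasDerivWithinAt_comp_curve (hL : 0 < L)
    (hc : ContMDiffOn 𝓘(ℝ, ℝ) (𝓡 2) ∞ c (Icc 0 L)) {g : M → F}
    (hg : ContMDiff (𝓡 2) 𝓘(ℝ, F) ∞ g) {s : ℝ} (hs : s ∈ Icc 0 L) :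
    HasDerivWithinAt (fun t => g (c t))
      (Sg.ambientDiff g (c s) (derivWithin (fun t => Sg.imm (c t)) (Icc 0 L) s)) (Icc 0 L) s := by
  rw [(hasDerivWithinAt_comp_curve_mfderivWithin hc Sg.contMDiff_imm hs).derivWithin
    (uniqueDiffOn_Icc hL s hs), ambientDiff_surfaceDiff]
  exact hasDerivWithinAt_comp_curve_mfderivWithin hc hg hs

/-- An edge of a curvature line net, parametrized by arc length, deviates from a principal
direction at its starting point at most quadratically. -/
theorem abs_sub_mul_inner_le_of_principal_curve [CompactSpace M] (hL : 0 < L)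
    (hc : ContMDiffOn 𝓘(ℝ, ℝ) (𝓡 2) ∞ c (Icc 0 L))
    (hT : ∀ s ∈ Icc 0 L, ‖derivWithin (fun t => Sg.imm (c t)) (Icc 0 L) s‖ = 1)
    (hprin : ∀ s ∈ Icc 0 L, Sg.IsPrincipalDirection (c s)
      (derivWithin (fun t => Sg.imm (c t)) (Icc 0 L) s))
    {k₀ κ : ℝ} {v : E3} (hv : ‖v‖ = 1) (hκ : Sg.ambientShape (c 0) v = κ • v)
    (hk₀ : Sg.ambientShape (c 0) (derivWithin (fun t => Sg.imm (c t)) (Icc 0 L) 0) =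
      k₀ • derivWithin (fun t => Sg.imm (c t)) (Icc 0 L) 0) :
    |(κ - k₀) * inner ℝ (Sg.imm (c L) - Sg.imm (c 0)) v| ≤
      (Sg.curvatureBound ^ 2 + 2 * Sg.curvatureDerivBound) * L ^ 2 := by
  have hud := uniqueDiffOn_Icc hL
  have h0 : (0 : ℝ) ∈ Icc 0 L := ⟨le_rfl, hL.le⟩
  have hfs : ContDiffOn ℝ ∞ (fun t => Sg.imm (c t)) (Icc 0 L) :=
    (Sg.contMDiff_imm.comp_contMDiffOn hc).contDiffOn
  have hTs : ContDiffOn ℝ ∞ (derivWithin (fun t => Sg.imm (c t)) (Icc 0 L)) (Icc 0 L) :=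
    hfs.derivWithin hud (by simp)
  -- Totalized so that `choose` yields a function on all of ℝ; its value off the interval is
  -- irrelevant.
  have hk : ∀ s, ∃ k : ℝ, s ∈ Icc 0 L →
      Sg.ambientShape (c s) (derivWithin (fun t => Sg.imm (c t)) (Icc 0 L) s) =
        k • derivWithin (fun t => Sg.imm (c t)) (Icc 0 L) s := by
    intro s
    by_cases hs : s ∈ Icc 0 L
    · obtain ⟨u, hu, -, k, hk⟩ := hprin s hs
      refine ⟨k, fun _ => ?_⟩
      rw [← hu, ambientShape_coe, hk]; rfl
    · exact ⟨0, fun h => absurd h hs⟩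
  choose k hk using hk
  have hk0 : k 0 = k₀ := by
    have h := (hk 0 h0).symm.trans hk₀
    rw [← sub_eq_zero, ← sub_smul, smul_eq_zero, sub_eq_zero] at h
    refine h.resolve_right fun h1 => ?_
    have := hT 0 h0
    rw [h1, norm_zero] at this
    exact zero_ne_one this
  rw [← hk0]
  have hnd : ∀ s ∈ Icc 0 L, HasDerivWithinAt (fun t => Sg.normal (c t))
      (-Sg.ambientShape (c s) (derivWithin (fun t => Sg.imm (c t)) (Icc 0 L) s))
      (Icc 0 L) s := by
    intro s hs
    refine (Sg.hasDerivWithinAt_comp_curve hL hc Sg.contMDiff_normal hs).congr_deriv ?_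
    rw [ambientShape_eq]; simp
  have hTn : ∀ s ∈ Icc 0 L,
      inner ℝ (derivWithin (fun t => Sg.imm (c t)) (Icc 0 L) s) (Sg.normal (c s)) = 0 := by
    intro s hs
    obtain ⟨u, hu, -⟩ := hprin s hs
    rw [← hu]; exact Sg.inner_coe_normal _ u
  have htan : ∀ s ∈ Icc 0 L, ∀ x y : E3, inner ℝ x (Sg.normal (c s)) = 0 →
      inner ℝ y (Sg.normal (c s)) = 0 →
      |inner ℝ (Sg.ambientDiff Sg.ambientShape (c s)
        (derivWithin (fun t => Sg.imm (c t)) (Icc 0 L) s) x) y| ≤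
      Sg.curvatureDerivBound * ‖x‖ * ‖y‖ := by
    intro s hs x y hx hy
    obtain ⟨u, hu, -⟩ := hprin s hs
    have h1 := hT s hs
    rw [← hu] at h1 ⊢
    exact Sg.abs_inner_ambientDiff_ambientShape_le (c s) u h1 hx hy
  have hAd : ∀ s ∈ Icc 0 L, HasDerivWithinAt (fun t => Sg.ambientShape (c t))
      (Sg.ambientDiff Sg.ambientShape (c s)
        (derivWithin (fun t => Sg.imm (c t)) (Icc 0 L) s)) (Icc 0 L) s :=
    fun s hs => Sg.hasDerivWithinAt_comp_curve hL hc Sg.contMDiff_ambientShape hs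
  have hfd : ∀ s ∈ Icc 0 L, HasDerivWithinAt (fun t => Sg.imm (c t))
      (derivWithin (fun t => Sg.imm (c t)) (Icc 0 L) s) (Icc 0 L) s :=
    fun s hs => (hfs.differentiableOn (by simp) s hs).hasDerivWithinAt
  generalize derivWithin (fun t => Sg.imm (c t)) (Icc 0 L) = T at *
  have hTd : ∀ s ∈ Icc 0 L, HasDerivWithinAt T (derivWithin T (Icc 0 L) s) (Icc 0 L) s :=
    fun s hs => (hTs.differentiableOn (by simp) s hs).hasDerivWithinAt
  exact abs_sub_mul_inner_le_of_curvatureLine (E := E3) (L := L) (K := Sg.curvatureBound)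
    (K' := Sg.curvatureDerivBound) (κ := κ)
    (A := fun s => Sg.ambientShape (c s))
    (A' := fun s => Sg.ambientDiff Sg.ambientShape (c s) (T s))
    (n := fun s => Sg.normal (c s)) (T := T) (T' := derivWithin T (Icc 0 L))
    (f := fun s => Sg.imm (c s)) (k := k) (v := v) hL Sg.curvatureDerivBound_nonneg
    hfd hTd hnd hAd (fun s _ => Sg.inner_ambientShape_comm (c s))
    (fun s _ => Sg.ambientShape_normal (c s)) (fun s _ => Sg.norm_normal (c s)) hT hTn hk
    (fun s _ => Sg.norm_ambientShape_le_curvatureBound (c s)) htan hv hκ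

end Curve

end OrientedImmersedSurface

/-! ### Linear algebra of the Darboux frame. -/

theorem Orthonormal.inner_pair {E : Type*} [NormedAddCommGroup E] [InnerProductSpace ℝ E]
    {v : Fin 2 → E} (h : Orthonormal ℝ v) (a b : ℝ) :
    inner ℝ (a • v 0 + b • v 1) (v 0) = a ∧ inner ℝ (a • v 0 + b • v 1) (v 1) = b ∧
      ‖a • v 0 + b • v 1‖ ^ 2 = a ^ 2 + b ^ 2 := by
  have h00 : inner ℝ (v 0) (v 0) = (1 : ℝ) := by simp [h.1]
  have h11 : inner ℝ (v 1) (v 1) = (1 : ℝ) := by simp [h.1]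
  have h01 : inner ℝ (v 0) (v 1) = (0 : ℝ) := h.2 (by simp)
  have h10 : inner ℝ (v 1) (v 0) = (0 : ℝ) := h.2 (by simp)
  refine ⟨?_, ?_, ?_⟩
  · simp [inner_add_left, inner_smul_left, h10, h.1]
  · simp [inner_add_left, inner_smul_left, h01, h.1]
  · rw [← real_inner_self_eq_norm_sq]
    simp only [inner_add_left, inner_add_right, inner_smul_left, inner_smul_right, h00, h11, h01,
      h10, conj_trivial]
    ring

theorem inner_smul_self_of_norm_eq_one {E : Type*} [NormedAddCommGroup E] [InnerProductSpace ℝ E]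
    {v : E} (h : ‖v‖ = 1) (k : ℝ) : inner ℝ (k • v) v = k := by
  simp [inner_smul_left, h]

namespace OrientedImmersedSurface

variable {M : Type*} [TopologicalSpace M] [ChartedSpace (EuclideanSpace ℝ (Fin 2)) M]
  [IsManifold (𝓡 2) ∞ M] {Sg : OrientedImmersedSurface M}

theorem IsPrincipalDirection.neg {p : M} {w : E3} (h : Sg.IsPrincipalDirection p w) :
    Sg.IsPrincipalDirection p (-w) := by
  obtain ⟨v, rfl, hv, k, hk⟩ := h
  exact ⟨-v, rfl, neg_ne_zero.2 hv, k, by rw [map_neg, hk, smul_neg]⟩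

namespace DarbouxFrame

variable {p : M} (D : Sg.DarbouxFrame p)

theorem inner_v_self (i : Fin 2) : inner ℝ (D.v i) (D.v i) = (1 : ℝ) := by
  rw [real_inner_self_eq_norm_sq, D.orthonormal.1 i]; norm_num

theorem shapeOperator_v (i : Fin 2) : Sg.shapeOperator p (D.v i) = D.kappa i • D.v i := by
  obtain ⟨v, hv, -, k, hk⟩ := D.principal i
  obtain rfl : v = D.v i := Subtype.ext hv
  have : D.kappa i = k := by
    rw [kappa, hk, inner_smul_self_of_norm_eq_one (D.orthonormal.1 i)]
  rw [this, hk]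

theorem ambientShape_v (i : Fin 2) :
    Sg.ambientShape p (D.v i : E3) = D.kappa i • (D.v i : E3) := by
  rw [ambientShape_coe, shapeOperator_v]; rfl

theorem exists_eq_add (u : Sg.tangentPlane p) : ∃ a b : ℝ, u = a • D.v 0 + b • D.v 1 := by
  have hfin : Module.finrank ℝ (Sg.tangentPlane p) = 2 := by
    rw [← (Sg.tangentEquiv p).finrank_eq]
    exact finrank_euclideanSpace_fin
  have hspan := D.orthonormal.linearIndependent.span_eq_top_of_card_eq_finrank
    (by rw [hfin, Fintype.card_fin])
  have hu : u ∈ Submodule.span ℝ (range D.v) := by rw [hspan]; trivial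
  obtain ⟨c, hc⟩ := (Submodule.mem_span_range_iff_exists_fun ℝ).1 hu
  exact ⟨c 0, c 1, by rw [← hc, Fin.sum_univ_two]⟩

/-- An eigenvector with both frame coordinates nonzero would force both principal curvatures to
equal its eigenvalue, making the point umbilical. So one coordinate vanishes and the other is ±1. -/
theorem eq_or_eq_neg_of_isPrincipalDirection (hp : ¬ Sg.IsUmbilical p) {w : E3}
    (hw : Sg.IsPrincipalDirection p w) (hnorm : ‖w‖ = 1) :
    ∃ i, w = (D.v i : E3) ∨ w = -(D.v i : E3) := by
  obtain ⟨u, rfl, -, k, hk⟩ := hw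
  have hnu : ‖u‖ = 1 := hnorm
  obtain ⟨a, b, rfl⟩ := D.exists_eq_add u
  obtain ⟨hu0, hu1, -⟩ := D.orthonormal.inner_pair (k * a) (k * b)
  have hab : a ^ 2 + b ^ 2 = 1 := by
    rw [← (D.orthonormal.inner_pair a b).2.2, hnu, one_pow]
  rw [map_add, map_smul, map_smul, shapeOperator_v, shapeOperator_v, smul_smul, smul_smul,
    smul_add, smul_smul, smul_smul] at hk
  obtain ⟨hw0, hw1, -⟩ := D.orthonormal.inner_pair (a * D.kappa 0) (b * D.kappa 1)
  have h0 : a * D.kappa 0 = k * a := by rw [← hw0, hk, hu0]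
  have h1 : b * D.kappa 1 = k * b := by rw [← hw1, hk, hu1]
  have hzero : a = 0 ∨ b = 0 := by
    by_contra! h
    refine hp ⟨k, fun x => ?_⟩
    have e0 : D.kappa 0 = k := mul_left_cancel₀ h.1 (by rw [h0, mul_comm])
    have e1 : D.kappa 1 = k := mul_left_cancel₀ h.2 (by rw [h1, mul_comm])
    obtain ⟨c, d, rfl⟩ := D.exists_eq_add x
    rw [map_add, map_smul, map_smul, shapeOperator_v, shapeOperator_v, e0, e1, smul_add,
      smul_comm c k, smul_comm d k]
  rcases hzero with rfl | rfl
  · refine ⟨1, ?_⟩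
    have hb : b = 1 ∨ b = -1 := by simpa using hab
    rcases hb with rfl | rfl <;> simp
  · refine ⟨0, ?_⟩
    have ha : a = 1 ∨ a = -1 := by simpa using hab
    rcases ha with rfl | rfl <;> simp

theorem index_unique {w : E3} {i j : Fin 2} (hi : w = (D.v i : E3) ∨ w = -(D.v i : E3))
    (hj : w = (D.v j : E3) ∨ w = -(D.v j : E3)) : i = j := by
  by_contra hne
  have h0 : inner ℝ (D.v i : E3) (D.v j : E3) = (0 : ℝ) := D.orthonormal.2 hne
  have h1 : inner ℝ (D.v i : E3) (D.v i : E3) = (1 : ℝ) := D.inner_v_self i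
  have h2 : (D.v j : E3) = D.v i ∨ (D.v j : E3) = -D.v i := by
    rcases hi with rfl | rfl <;> rcases hj with h | h
    · exact Or.inl h.symm
    · exact Or.inr (by rw [h, neg_neg])
    · exact Or.inr h.symm
    · exact Or.inl (neg_injective h).symm
  rcases h2 with h | h <;> rw [h] at h0
  · exact one_ne_zero (h1.symm.trans h0)
  · rw [inner_neg_right, h1] at h0; norm_num at h0

theorem abs_kappa_sub (i : Fin 2) : |D.kappa (1 - i) - D.kappa i| = |D.deltaKappa| := by
  fin_cases i
  · rfl
  · exact abs_sub_comm _ _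

end DarbouxFrame

end OrientedImmersedSurface

/-! ### Edges oriented away from a vertex. -/

namespace DiscreteNet

variable {M : Type*} [TopologicalSpace M] [T2Space M]
  [ChartedSpace (EuclideanSpace ℝ (Fin 2)) M] [IsManifold (𝓡 2) ∞ M]
  {Sg : OrientedImmersedSurface M} (N : DiscreteNet Sg)

theorem differentiableOn_imm_param (e : N.Edge) :
    DifferentiableOn ℝ (fun t => Sg.imm (N.param e t)) (Icc 0 (N.len e)) :=
  (Sg.contMDiff_imm.comp_contMDiffOn (N.contMDiffOn_param e)).contDiffOn.differentiableOn (by simp)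

theorem derivWithin_imm_param_reverse (e : N.Edge) {s : ℝ} (hs : s ∈ Icc 0 (N.len e)) :
    derivWithin (fun t => Sg.imm (N.param e (N.len e - t))) (Icc 0 (N.len e)) s =
      -derivWithin (fun t => Sg.imm (N.param e t)) (Icc 0 (N.len e)) (N.len e - s) := by
  have hmaps : MapsTo (fun t : ℝ => N.len e - t) (Icc 0 (N.len e)) (Icc 0 (N.len e)) :=
    fun t ht => ⟨by linarith [ht.2], by linarith [ht.1]⟩
  have h1 := (N.differentiableOn_imm_param e _ (hmaps hs)).hasDerivWithinAt
  have h2 : HasDerivWithinAt (fun t : ℝ => N.len e - t) (-1) (Icc 0 (N.len e)) s :=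
    (hasDerivWithinAt_id s _).const_sub _
  have h3 := h1.scomp s h2 hmaps
  rw [neg_one_smul] at h3
  exact h3.derivWithin (uniqueDiffOn_Icc (N.len_pos e) s hs)

theorem contMDiffOn_outParam (e : N.Edge) (p : M) :
    ContMDiffOn 𝓘(ℝ, ℝ) (𝓡 2) ∞ (N.outParam e p) (Icc 0 (N.len e)) := by
  unfold outParam
  split_ifs
  · exact N.contMDiffOn_param e
  · have h : ContMDiffOn 𝓘(ℝ, ℝ) 𝓘(ℝ, ℝ) ∞ (fun t : ℝ => N.len e - t) (Icc 0 (N.len e)) :=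
      (contDiff_const.sub contDiff_id).contMDiff.contMDiffOn
    exact (N.contMDiffOn_param e).comp h
      fun t ht => ⟨by linarith [ht.2], by linarith [ht.1]⟩

theorem outParam_zero {e : N.Edge} {p : M} (he : N.Emanates e p) : N.outParam e p 0 = p := by
  unfold outParam
  split_ifs with h
  · exact h
  · exact (congrArg (N.param e) (sub_zero (N.len e))).trans (he.resolve_left h)

theorem norm_derivWithin_outParam (e : N.Edge) (p : M) {s : ℝ} (hs : s ∈ Icc 0 (N.len e)) :
    ‖derivWithin (fun t => Sg.imm (N.outParam e p t)) (Icc 0 (N.len e)) s‖ = 1 := by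
  unfold outParam
  split_ifs
  · exact N.norm_deriv_param e s hs
  · rw [N.derivWithin_imm_param_reverse e hs, norm_neg]
    exact N.norm_deriv_param e _ ⟨by linarith [hs.2], by linarith [hs.1]⟩

variable {N}

theorem IsCurvatureLineNet.principal_outParam (hN : N.IsCurvatureLineNet) (e : N.Edge) (p : M)
    {s : ℝ} (hs : s ∈ Icc 0 (N.len e)) :
    Sg.IsPrincipalDirection (N.outParam e p s)
      (derivWithin (fun t => Sg.imm (N.outParam e p t)) (Icc 0 (N.len e)) s) := by
  unfold outParam
  split_ifs
  · exact hN.principal e s hs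
  · rw [N.derivWithin_imm_param_reverse e hs]
    exact (hN.principal e _ ⟨by linarith [hs.2], by linarith [hs.1]⟩).neg

/-- Valence four, being a nonzero `Nat.card`, forces the set of emanating edges to be finite, so the
real supremum is bounded above. -/
theorem IsCurvatureLineNet.len_le_maxEdgeLength (hN : N.IsCurvatureLineNet) {p : M}
    (hp : N.IsVertex p) (hpu : ¬ Sg.IsUmbilical p) {e : N.Edge} (he : N.Emanates e p) :
    N.len e ≤ N.maxEdgeLength p := by
  have hcard : Nat.card {e : N.Edge // N.Emanates e p} = 4 := hN.valence_eq p hp hpu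
  have : Finite {e : N.Edge // N.Emanates e p} :=
    Nat.finite_of_card_ne_zero (by rw [hcard]; norm_num)
  exact le_ciSup (f := fun e : {e : N.Edge // N.Emanates e p} => N.len e.1)
    (Set.finite_range _).bddAbove ⟨e, he⟩

end DiscreteNet

/-! ### Conclusion at a vertex of the net. -/

theorem mainTheorem5 {M : Type*} [TopologicalSpace M] [T2Space M] [CompactSpace M]
    [ChartedSpace (EuclideanSpace ℝ (Fin 2)) M] [IsManifold (𝓡 2) ∞ M]
    (Sg : OrientedImmersedSurface M) (N : DiscreteNet Sg) (hN : N.IsCurvatureLineNet)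
    (p : M) (hp : N.IsVertex p) (hpu : ¬ Sg.IsUmbilical p) (D : Sg.DarbouxFrame p)
    (e : N.Edge) (he : N.Emanates e p) :
    (∃! i : Fin 2, N.IsAssociated e D i) ∧
      ∀ i : Fin 2, N.IsAssociated e D i →
        |D.deltaKappa * N.tangentialDeviation e D i| ≤
          (Sg.curvatureBound ^ 2 + 4 * Sg.curvatureDerivBound) * N.maxEdgeLength p ^ 2 := by
  have hL : 0 < N.len e := N.len_pos e
  have h0 : (0 : ℝ) ∈ Icc 0 (N.len e) := ⟨le_rfl, hL.le⟩
  have hstart := N.outParam_zero he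
  constructor
  · have hprin := hN.principal_outParam e p h0
    rw [hstart] at hprin
    obtain ⟨i, hi⟩ := D.eq_or_eq_neg_of_isPrincipalDirection hpu hprin
      (N.norm_derivWithin_outParam e p h0)
    exact ⟨i, hi, fun j hj => D.index_unique hj hi⟩
  · intro i hi
    have hk₀ : Sg.ambientShape (N.outParam e p 0) (N.edgeTangent e p) =
        D.kappa i • N.edgeTangent e p := by
      rw [hstart]
      rcases hi with h | h <;> rw [h]
      · exact D.ambientShape_v i
      · rw [map_neg, D.ambientShape_v, smul_neg]
    have hκ : Sg.ambientShape (N.outParam e p 0) (D.v (1 - i) : E3) =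
        D.kappa (1 - i) • (D.v (1 - i) : E3) := by
      rw [hstart]; exact D.ambientShape_v _
    -- In `Fin 2`, `1 - i` is the other index: the test vector is the principal direction to which
    -- the edge is not tangent.
    have key := Sg.abs_sub_mul_inner_le_of_principal_curve hL (N.contMDiffOn_outParam e p)
      (fun s hs => N.norm_derivWithin_outParam e p hs)
      (fun s hs => hN.principal_outParam e p hs) (D.orthonormal.1 (1 - i)) hκ hk₀
    rw [hstart, abs_mul, D.abs_kappa_sub] at key
    rw [abs_mul, DiscreteNet.tangentialDeviation, abs_abs]
    refine key.trans ?_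
    have hle := hN.len_le_maxEdgeLength hp hpu he
    have hK' := Sg.curvatureDerivBound_nonneg
    -- The proved coefficient 2 of the derivative bound is relaxed to 4, and the edge length to the
    -- maximal one.
    gcongr
    linarith
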